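/- **Model.** An access point (AP) serves $N$ clients. Time is slotted, and slots are grouped into periods $[kT,(k+1)T)$, $k=0,1,2,\dots$, of length $T\ge 1$. The channel state $c_k$ in period $k$ is a stationary, irreducible Markov chain on a finite set; the packet arrivals are driven by a stationary, irreducible finite-state Markov chain, independent of the channel, whose state in period $k$ determines the set $S_k$ of clients for which one packet arrives at the beginning of period $k$. There is no rate adaptation: the AP makes at most one transmission per slot, and under channel state $c$ a transmission to client $n$ succeeds, independently of everything else, with probability $p_{c,n}\in[0,1]$. All clients have the same delay bound $\tau\le T$: a packet not delivered in the first $\tau$ slots of its period is discarded. Let $d_n(t)$ be the number of packets delivered to client $n$ up to time slot $t$. A *priority-based policy* assigns, at the beginning of each period, priorities to some of the clients (an ordered list of distinct clients), possibly at random, on the basis of the past history and the current state of the system; during the period the AP always transmits the undelivered packet whose client has the highest priority, and never transmits packets of clients without a priority. Let $\mathbb{P}$ be the set of these policies. Requirements $[q_n]$ are *fulfilled* by a policy if for every $\varepsilon>0$, $\mathrm{Prob}\{d_n(t)/(t/T)>q_n-\varepsilon \text{ for every } n\}\to 1$ as $t\to\infty$; they are *feasible in $\mathbb{P}$* if some policy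 in $\mathbb{P}$ fulfills them, and *strictly feasible in $\mathbb{P}$* if $[q_n/\alpha]$ is feasible in $\mathbb{P}$ for some $\alpha\in(0,1)$. A policy (which may use the $q_n$) is *feasibility optimal in $\mathbb{P}$* if it fulfills every $[q_n]$ with all $q_n>0$ that is strictly feasible in $\mathbb{P}$. For debts $[r_n]\in\mathbb{R}^N$, channel state $c$ and set $S$ of arrived packets, the *payoff* of a (possibly random) priority ordering is $\sum_{n=1}^N r_n^+\,E\{\mu_n\}$, where $\mu_n=1$ if the packet of client $n$ is delivered in the period and $\mu_n=0$ otherwise, $c$ and $S$ being fixed. A *joint debt-channel ordering* for $([r_n],c,S)$ lists exactly the clients $n\in S$ with $r_n>0$ in decreasing order of $r_n p_{c,n}$, with ties broken arbitrarily (a client with $p_{c,n}=0$ may be listed or omitted). A *joint debt-channel policy* uses in each period $k$ a joint debt-channel ordering for the current channel state, the current set of arrived packets and the delivery debts $r_n=q_nk-d_n(kT)$. **Theorem (Joint Debt-Channel Policy).** 1. For all $[r_n]\in\mathbb{R}^N$, $c$ and $S$, every joint debt-channel ordering maximises the payoff among all (possibly random) priority orderings. 2. For every $[q_n]$ a joint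 debt-channel policy exists, and every joint debt-channel policy (whatever its tie-breaking) is feasibility optimal in $\mathbb{P}$. -/

import Mathlib

noncomputable section

namespace DebtScheduling

/-- A finite-state, time-homogeneous Markov chain in discrete time that is stationary (it is started
in an invariant distribution) and irreducible (every state leads to every state with positive
probability in finitely many steps). -/
structure StationaryChain (E : Type*) where
  init : PMF E
  step : E → PMF E
  stationary : init.bind step = init
  irreducible : ∀ a b : E, Relation.ReflTransGen (fun x y => y ∈ (step x).support) a b

/-- The wireless system without rate adaptation, with time-varying channels and a common delay bound:
`N` clients, channel states `C`, states `X` of the packet-arrival process.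
The channel process and the arrival process are independent of each other; both are constant within
a period. -/
structure System (N : ℕ) (C X : Type*) where
  /-- period length, in slots -/
  T : ℕ
  T_pos : 0 < T
  /-- common delay bound, in slots -/
  τ : ℕ
  τ_le_T : τ ≤ T
  channel : StationaryChain C
  arrival : StationaryChain X
  /-- the set of clients for which a packet arrives when the arrival process is in a given state -/
  arrivals : X → Finset (Fin N)
  /-- link reliability `p c n` of client `n` under channel state `c` -/
  p : C → Fin N → unitInterval

/-- What happens in one slot: `none` if the AP stays idle, `some (n, b)` if it transmits the packet
of client `n`; `b` tells whether the transmission is successful. -/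
abbrev Slot (N : ℕ) : Type := Option (Fin N × Bool)

/-- An assignment of priorities to some of the clients: the clients that receive a priority, listed
from the highest priority to the lowest. -/
abbrev PriorityOrder (N : ℕ) : Type := {l : List (Fin N) // l.Nodup}

/-- The record of one full period: channel state, arrival state, priorities, and the `T` slots. -/
structure PeriodRecord (N : ℕ) (C X : Type*) where
  chan : C
  arr : X
  order : PriorityOrder N
  slots : List (Slot N)

/-- The records of the completed periods, the most recent period first. -/
abbrev History (N : ℕ) (C X : Type*) : Type _ := List (PeriodRecord N C X)

/-- A (possibly randomized) priority-based policy: at the beginning of each period it chooses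
priorities at random, with a distribution that depends on the past history and on the current channel
and arrival state. -/
abbrev PriorityPolicy (N : ℕ) (C X : Type*) : Type _ :=
  History N C X → C → X → PMF (PriorityOrder N)

/-- Success (`true`) with probability `p`, failure with probability `1 - p`. -/
def coin (p : unitInterval) : PMF Bool :=
  PMF.ofFintype (fun b => if b then ENNReal.ofReal p else ENNReal.ofReal (1 - p)) (by
    have h0 : (0 : ℝ) ≤ p := p.2.1
    have h1 : (0 : ℝ) ≤ 1 - p := sub_nonneg.2 p.2.2
    simp only [Fintype.sum_bool, if_true, Bool.false_eq_true, if_false]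
    rw [← ENNReal.ofReal_add h0 h1]
    simp)

/-- The next `m` slots when the packets in `queue` are pending: in each slot the AP transmits the
first pending packet; if the transmission succeeds the packet leaves the queue, and otherwise it is
transmitted again. The AP is idle once the queue is empty. -/
def transmit {N : ℕ} (p : Fin N → unitInterval) : ℕ → List (Fin N) → PMF (List (Slot N))
  | 0, _ => PMF.pure []
  | m + 1, [] => (transmit p m []).map (fun log => none :: log)
  | m + 1, n :: queue => (coin (p n)).bind fun success =>
      (transmit p m (if success then queue else n :: queue)).map
        (fun log => some (n, success) :: log)

/-- The slots of all periods of a history, concatenated in chronological order. -/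
def slotLog {N : ℕ} {C X : Type*} : History N C X → List (Slot N)
  | [] => []
  | r :: h => slotLog h ++ r.slots

/-- `d_n(t)`: the number of packets delivered to client `n` in the slots `0, …, t - 1`. -/
def deliveredBy {N : ℕ} {C X : Type*} (h : History N C X) (n : Fin N) (t : ℕ) : ℕ :=
  ((slotLog h).take t).count (some (n, true))

namespace System

variable {N : ℕ} {C X : Type*} (M : System N C X)

/-- The law of the `T` slots of a period with channel state `c`, set `S` of arrived packets and
priority order `l`. Transmissions are made in the first `τ` slots; afterwards all packets of the
period have expired. Packets of clients without a priority are never transmitted. -/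
def periodLaw (c : C) (S : Finset (Fin N)) (l : PriorityOrder N) : PMF (List (Slot N)) :=
  (transmit (M.p c) M.τ (l.1.filter (· ∈ S))).map
    (fun log => log ++ List.replicate (M.T - M.τ) none)

/-- The law of the channel state of the next period. -/
def nextChannel : History N C X → PMF C
  | [] => M.channel.init
  | r :: _ => M.channel.step r.chan

/-- The law of the arrival state of the next period. -/
def nextArrival : History N C X → PMF X
  | [] => M.arrival.init
  | r :: _ => M.arrival.step r.arr

/-- The law of the history of the first `k` periods under the policy `η`. -/
def law (η : PriorityPolicy N C X) : ℕ → PMF (History N C X)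
  | 0 => PMF.pure []
  | k + 1 => (law η k).bind fun h =>
      (M.nextChannel h).bind fun c =>
      (M.nextArrival h).bind fun x =>
      (η h c x).bind fun l =>
      (M.periodLaw c (M.arrivals x) l).map fun log => ⟨c, x, l, log⟩ :: h

/-- The set of clients with timely-throughput requirements `q` is fulfilled under `η`: for every
`ε > 0` the probability that `d_n(t) / (t / T) > q_n - ε` for every `n` tends to `1` as `t → ∞`.
(The first `t / T + 1` periods contain the slots `0, …, t - 1`.) -/
def Fulfills (η : PriorityPolicy N C X) (q : Fin N → ℝ) : Prop :=
  ∀ ε : ℝ, 0 < ε → Filter.Tendsto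
    (fun t : ℕ => (M.law η (t / M.T + 1)).toOuterMeasure
      {h | ∀ n, q n - ε < (deliveredBy h n t : ℝ) / ((t : ℝ) / (M.T : ℝ))})
    Filter.atTop (nhds 1)

/-- `q` is feasible in the set of priority-based policies. -/
def Feasible (q : Fin N → ℝ) : Prop :=
  ∃ η : PriorityPolicy N C X, M.Fulfills η q

/-- `q` is strictly feasible in the set of priority-based policies. -/
def StrictlyFeasible (q : Fin N → ℝ) : Prop :=
  ∃ α : ℝ, 0 < α ∧ α < 1 ∧ M.Feasible (fun n => q n / α)

/-- Feasibility optimality among the priority-based policies. A policy may use the requirements `q`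
of the clients, so it is given as a family indexed by `q`. -/
def FeasibilityOptimal (η : (Fin N → ℝ) → PriorityPolicy N C X) : Prop :=
  ∀ q : Fin N → ℝ, (∀ n, 0 < q n) → M.StrictlyFeasible q → M.Fulfills (η q) q

/-- The delivery debt `r_n = q_n k - d_n(kT)` after the `k` periods of the history `h`. -/
def deliveryDebt (q : Fin N → ℝ) (h : History N C X) (n : Fin N) : ℝ :=
  q n * (h.length : ℝ) - (deliveredBy h n (h.length * M.T) : ℝ)

/-- The payoff `∑ n, r_n⁺ E[μ_n]` of a period with debts `r`, given channel state `c` and set `S` of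
arrived packets, when the priority order is drawn from `D`. Here `μ_n` is `1` if the packet of
client `n` is delivered in the period and `0` otherwise. -/
def payoff (r : Fin N → ℝ) (c : C) (S : Finset (Fin N)) (D : PMF (PriorityOrder N)) : ℝ :=
  ∑ n, max (r n) 0 *
    ((D.bind (M.periodLaw c S)).toOuterMeasure {log | some (n, true) ∈ log}).toReal

/-- `l` is a priority order that the joint debt-channel rule may choose, given debts `r`, channel
state `c` and set `S` of arrived packets: it lists the clients with a packet and a positive debt by
decreasing `r_n * p_{c,n}`. Ties are broken arbitrarily, and a client with `p_{c,n} = 0` may be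
listed or not. -/
def IsJointDebtChannelOrder (r : Fin N → ℝ) (c : C) (S : Finset (Fin N))
    (l : PriorityOrder N) : Prop :=
  (∀ n ∈ l.1, n ∈ S ∧ 0 < r n) ∧
  (∀ n ∈ S, 0 < r n * (M.p c n : ℝ) → n ∈ l.1) ∧
  l.1.Pairwise (fun a b => r b * (M.p c b : ℝ) ≤ r a * (M.p c a : ℝ))

/-- `η` is a joint debt-channel policy for the requirements `q`: at the beginning of each period it
chooses priorities by the joint debt-channel rule for the current delivery debts. -/
def IsJointDebtChannelPolicy (q : Fin N → ℝ) (η : PriorityPolicy N C X) : Prop :=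
  ∀ (h : History N C X) (c : C) (x : X), ∀ l ∈ (η h c x).support,
    M.IsJointDebtChannelOrder (M.deliveryDebt q h) c (M.arrivals x) l

end System

end DebtScheduling

end

/-!
Within a period, the payoff of a priority order is the expected reward of a queue in which every
delivery to client `n` is worth `w n = max (r n) 0`. The queue sorted by decreasing `w n * p n`
satisfies the Bellman inequality `le_queueValue_succ_of_sorted`: serving another client first and
then following the sorted order brings no gain, because the first two services can be interchanged.
Hence the sorted queue is optimal (`queueValue_le_of_sorted`, `orderValue_eq_optValue`).

For feasibility optimality the sum of the squares of the positive parts of the delivery debts is used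
as a Lyapunov function. Its growth over a block of `m` periods that starts with debts `w` is governed
by the difference between `m * ∑ n, w n * q n` and the reward collected in the block with weights
`w`. A joint debt-channel policy maximises the reward of every period for the current debts, which
stay close to `w` during the block, so it collects the largest possible total reward `optTotal w m`
up to an error that does not depend on `w` (`expect_run_lyapunov_add_le`).

It remains to bound `optTotal w m` from below for one fixed `m`, all `w ≥ 0` and all initial channel
and arrival states. The joint chain of the two states may be reducible and periodic, and no ergodic
theorem is used. Instead, every initial state has positive probability, so a policy fulfilling
`q n / α` also fulfils it conditionally on each initial state; since no policy collects more than
`optTotal`, for `m` large this gives `m * ∑ n, w n * q n ≤ optTotal w m` (`exists_le_optTotal`). The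
probability involved does not depend on `w`, so a single `m` serves all weights. The slack between
`q n / α` and `q n` absorbs all the errors made.

Consequently the expectation of the Lyapunov function grows at most linearly in the number of
periods (`exists_expect_lyapunov_le`), and Chebyshev's inequality shows that the debts are sublinear
in probability (`fulfills_of_expect_lyapunov_le`).
-/

namespace DebtScheduling

/-! ### Expectations over finitely supported laws -/

/-- A law with finitely many possible outcomes. -/
class FinSupp {α : Type*} (p : PMF α) : Prop where
  finite : p.support.Finite

/-- The expectation of `f` under the law `p`. It is used for finitely supported `p` only, so no
summability condition arises. -/
noncomputable def expect {α : Type*} (p : PMF α) (f : α → ℝ) : ℝ := ∑' a, (p a).toReal * f a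

instance FinSupp.of_finite {α : Type*} [Finite α] (p : PMF α) : FinSupp p := ⟨Set.toFinite _⟩

instance FinSupp.pure {α : Type*} (a : α) : FinSupp (PMF.pure a) :=
  ⟨by rw [PMF.support_pure]; exact Set.finite_singleton a⟩

instance FinSupp.bind {α β : Type*} (p : PMF α) (g : α → PMF β) [hp : FinSupp p]
    [hg : ∀ a, FinSupp (g a)] : FinSupp (p.bind g) :=
  ⟨by rw [PMF.support_bind]; exact hp.finite.biUnion fun a _ => (hg a).finite⟩

instance FinSupp.map {α β : Type*} (f : α → β) (p : PMF α) [hp : FinSupp p] :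
    FinSupp (p.map f) :=
  ⟨by rw [PMF.support_map]; exact hp.finite.image f⟩

section expect

variable {α β : Type*}

lemma expect_eq_sum (p : PMF α) (f : α → ℝ) (s : Finset α) (hs : p.support ⊆ s) :
    expect p f = ∑ a ∈ s, (p a).toReal * f a := by
  refine tsum_eq_sum fun a ha => ?_
  have : p a = 0 := by
    by_contra h
    exact ha (hs h)
  simp [this]

lemma sum_toReal_eq_one (p : PMF α) (s : Finset α) (hs : p.support ⊆ s) :
    ∑ a ∈ s, (p a).toReal = 1 := by
  rw [← ENNReal.toReal_sum fun a _ => p.apply_ne_top a]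
  have h : ∑ a ∈ s, p a = 1 := by
    rw [← p.tsum_coe]
    refine (tsum_eq_sum fun a ha => ?_).symm
    by_contra h
    exact ha (hs h)
  simp [h]

lemma expect_pure (a : α) (f : α → ℝ) : expect (PMF.pure a) f = f a := by
  classical
  rw [expect_eq_sum _ f {a} (by simp [PMF.support_pure])]
  simp

lemma expect_coin (p : unitInterval) (f : Bool → ℝ) :
    expect (coin p) f = p * f true + (1 - p) * f false := by
  have h0 : (0 : ℝ) ≤ p := p.2.1
  have h1 : (0 : ℝ) ≤ 1 - p := sub_nonneg.2 p.2.2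
  rw [expect_eq_sum _ f Finset.univ fun b _ => Finset.mem_coe.2 (Finset.mem_univ b)]
  simp [coin, h0, ENNReal.toReal_ofReal h1]

lemma expect_bind (p : PMF α) (g : α → PMF β) [hp : FinSupp p] [hg : ∀ a, FinSupp (g a)]
    (f : β → ℝ) : expect (p.bind g) f = expect p fun a => expect (g a) f := by
  classical
  set s := hp.finite.toFinset
  set t := s.biUnion fun a => (hg a).finite.toFinset
  have hs : p.support ⊆ s := by simp [s]
  have ht : ∀ a ∈ s, (g a).support ⊆ t := by
    intro a ha b hb
    simp only [t, Finset.coe_biUnion, Set.mem_iUnion]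
    exact ⟨a, ha, by simpa using hb⟩
  have hb : (p.bind g).support ⊆ t := by
    rw [PMF.support_bind]
    intro b hb
    simp only [Set.mem_iUnion] at hb
    obtain ⟨a, ha, hb⟩ := hb
    exact ht a (hs ha) hb
  have happ : ∀ b, ((p.bind g) b).toReal = ∑ a ∈ s, (p a).toReal * (g a b).toReal := by
    intro b
    rw [PMF.bind_apply, tsum_eq_sum (s := s), ENNReal.toReal_sum]
    · simp
    · exact fun a _ => ENNReal.mul_ne_top (p.apply_ne_top a) ((g a).apply_ne_top b)
    · intro a ha
      have : p a = 0 := by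
        by_contra h
        exact ha (hs h)
      simp [this]
  rw [expect_eq_sum _ f t hb, expect_eq_sum p _ s hs]
  simp only [happ, Finset.sum_mul]
  rw [Finset.sum_comm]
  refine Finset.sum_congr rfl fun a ha => ?_
  rw [expect_eq_sum _ f t (ht a ha), Finset.mul_sum]
  exact Finset.sum_congr rfl fun b _ => mul_assoc _ _ _

lemma expect_map (p : PMF α) (g : α → β) [FinSupp p] (f : β → ℝ) :
    expect (p.map g) f = expect p fun a => f (g a) := by
  have h : p.map g = p.bind fun a => PMF.pure (g a) := rfl
  simp only [h, expect_bind, expect_pure]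

lemma expect_congr {p : PMF α} {f g : α → ℝ} (h : ∀ a ∈ p.support, f a = g a) :
    expect p f = expect p g := by
  refine tsum_congr fun a => ?_
  by_cases ha : p a = 0
  · simp [ha]
  · rw [h a ha]

lemma expect_mono {p : PMF α} [hp : FinSupp p] {f g : α → ℝ} (h : ∀ a ∈ p.support, f a ≤ g a) :
    expect p f ≤ expect p g := by
  rw [expect_eq_sum p f hp.finite.toFinset (by simp), expect_eq_sum p g hp.finite.toFinset (by simp)]
  exact Finset.sum_le_sum fun a ha =>
    mul_le_mul_of_nonneg_left (h a (by simpa using ha)) ENNReal.toReal_nonneg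

lemma expect_const (p : PMF α) [hp : FinSupp p] (x : ℝ) : expect p (fun _ => x) = x := by
  rw [expect_eq_sum p _ hp.finite.toFinset (by simp), ← Finset.sum_mul,
    sum_toReal_eq_one p _ (by simp), one_mul]

lemma expect_add (p : PMF α) [hp : FinSupp p] (f g : α → ℝ) :
    expect p (fun a => f a + g a) = expect p f + expect p g := by
  simp only [expect_eq_sum p _ hp.finite.toFinset (by simp), mul_add, Finset.sum_add_distrib]

lemma expect_const_mul (p : PMF α) [hp : FinSupp p] (x : ℝ) (f : α → ℝ) :
    expect p (fun a => x * f a) = x * expect p f := by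
  simp only [expect_eq_sum p _ hp.finite.toFinset (by simp), Finset.mul_sum]
  exact Finset.sum_congr rfl fun a _ => mul_left_comm _ _ _

lemma expect_sum {ι : Type*} (s : Finset ι) (p : PMF α) [hp : FinSupp p] (f : ι → α → ℝ) :
    expect p (fun a => ∑ i ∈ s, f i a) = ∑ i ∈ s, expect p (f i) := by
  simp only [expect_eq_sum p _ hp.finite.toFinset (by simp), Finset.mul_sum]
  exact Finset.sum_comm

lemma expect_nonneg {p : PMF α} [FinSupp p] {f : α → ℝ} (h : ∀ a ∈ p.support, 0 ≤ f a) :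
    0 ≤ expect p f := by
  simpa [expect_const] using expect_mono (p := p) h

lemma expect_le {p : PMF α} [FinSupp p] {f : α → ℝ} {x : ℝ} (h : ∀ a ∈ p.support, f a ≤ x) :
    expect p f ≤ x := by
  simpa [expect_const] using expect_mono (p := p) h

lemma le_expect {p : PMF α} [FinSupp p] {f : α → ℝ} {x : ℝ} (h : ∀ a ∈ p.support, x ≤ f a) :
    x ≤ expect p f := by
  simpa [expect_const] using expect_mono (p := p) h

lemma toReal_mul_le_expect (p : PMF α) [hp : FinSupp p] {f : α → ℝ} (hf : ∀ a, 0 ≤ f a) (a : α) :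
    (p a).toReal * f a ≤ expect p f := by
  classical
  rw [expect_eq_sum p f (insert a hp.finite.toFinset) (by simp)]
  exact Finset.single_le_sum (f := fun a => (p a).toReal * f a)
    (fun b _ => mul_nonneg ENNReal.toReal_nonneg (hf b)) (Finset.mem_insert_self _ _)

lemma toReal_toOuterMeasure (p : PMF α) [hp : FinSupp p] (s : Set α) :
    (p.toOuterMeasure s).toReal = expect p (s.indicator 1) := by
  classical
  rw [PMF.toOuterMeasure_apply, expect_eq_sum p _ hp.finite.toFinset (by simp),
    tsum_eq_sum (s := hp.finite.toFinset), ENNReal.toReal_sum]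
  · refine Finset.sum_congr rfl fun a _ => ?_
    by_cases ha : a ∈ s <;> simp [ha]
  · intro a _
    by_cases ha : a ∈ s <;> simp [ha, p.apply_ne_top]
  · intro a ha
    have : p a = 0 := by simpa using ha
    by_cases ha : a ∈ s <;> simp [ha, this]

lemma toOuterMeasure_le_one (p : PMF α) (s : Set α) : p.toOuterMeasure s ≤ 1 := by
  rw [PMF.toOuterMeasure_apply, ← p.tsum_coe]
  exact ENNReal.tsum_le_tsum fun a => Set.indicator_le_self _ _ _

end expect

/-! ### The slots of one period -/

section transmit

variable {N : ℕ} (p : Fin N → unitInterval)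

instance FinSupp.transmit (m : ℕ) (queue : List (Fin N)) :
    FinSupp (DebtScheduling.transmit p m queue) := by
  induction m generalizing queue with
  | zero => unfold DebtScheduling.transmit; infer_instance
  | succ m ih => cases queue <;> (unfold DebtScheduling.transmit; infer_instance)

lemma length_of_mem_support_transmit {m : ℕ} {queue : List (Fin N)} {log : List (Slot N)}
    (h : log ∈ (transmit p m queue).support) : log.length = m := by
  induction m generalizing queue log with
  | zero =>
    simp only [transmit, PMF.support_pure, Set.mem_singleton_iff] at h
    simp [h]
  | succ m ih =>
    cases queue with
    | nil =>
      simp only [transmit, PMF.support_map, Set.mem_image] at h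
      obtain ⟨log, h, rfl⟩ := h
      simp [ih h]
    | cons n queue =>
      simp only [transmit, PMF.support_bind, PMF.support_map, Set.mem_iUnion, Set.mem_image] at h
      obtain ⟨b, -, log, h, rfl⟩ := h
      simp [ih h]

/-- A client is served at most as often as it has packets in the queue. -/
lemma count_le_of_mem_support_transmit {m : ℕ} {queue : List (Fin N)} {log : List (Slot N)}
    (h : log ∈ (transmit p m queue).support) (n : Fin N) :
    log.count (some (n, true)) ≤ queue.count n := by
  induction m generalizing queue log with
  | zero =>
    simp only [transmit, PMF.support_pure, Set.mem_singleton_iff] at h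
    simp [h]
  | succ m ih =>
    cases queue with
    | nil =>
      simp only [transmit, PMF.support_map, Set.mem_image] at h
      obtain ⟨log, h, rfl⟩ := h
      simpa using ih h
    | cons a queue =>
      simp only [transmit, PMF.support_bind, PMF.support_map, Set.mem_iUnion, Set.mem_image] at h
      obtain ⟨b, -, log, h, rfl⟩ := h
      have := ih h
      cases b
      · simpa [List.count_cons] using this
      · simp only [List.count_cons, if_true] at this ⊢
        by_cases ha : a = n <;> simp [ha] <;> omega

/-- The total reward of a slot log, when a delivery to client `n` is worth `w n`. -/
def reward (w : Fin N → ℝ) (log : List (Slot N)) : ℝ :=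
  ∑ n, w n * (log.count (some (n, true)) : ℝ)

lemma reward_nil (w : Fin N → ℝ) : reward w [] = 0 := by simp [reward]

lemma reward_cons_none (w : Fin N → ℝ) (log : List (Slot N)) :
    reward w (none :: log) = reward w log := by simp [reward]

lemma reward_cons_some (w : Fin N → ℝ) (n : Fin N) (b : Bool) (log : List (Slot N)) :
    reward w (some (n, b) :: log) = (if b then w n else 0) + reward w log := by
  cases b
  · simp [reward]
  · simp [reward, List.count_cons, mul_add, Finset.sum_add_distrib, add_comm]

lemma reward_append (w : Fin N → ℝ) (log log' : List (Slot N)) :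
    reward w (log ++ log') = reward w log + reward w log' := by
  simp [reward, mul_add, Finset.sum_add_distrib]

lemma reward_replicate_none (w : Fin N → ℝ) (m : ℕ) :
    reward w (List.replicate m none) = 0 := by
  simp [reward, List.count_replicate]

/-- The expected reward of `m` slots when the packets in `queue` are pending. -/
noncomputable def queueValue (w : Fin N → ℝ) (m : ℕ) (queue : List (Fin N)) : ℝ :=
  expect (transmit p m queue) (reward w)

variable {w : Fin N → ℝ}

lemma queueValue_zero (queue : List (Fin N)) : queueValue p w 0 queue = 0 := by
  simp [queueValue, transmit, expect_pure, reward_nil]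

lemma queueValue_nil (m : ℕ) : queueValue p w m [] = 0 := by
  induction m with
  | zero => exact queueValue_zero p []
  | succ m ih => simpa [queueValue, transmit, expect_map, reward_cons_none] using ih

lemma queueValue_succ_cons (m : ℕ) (n : Fin N) (queue : List (Fin N)) :
    queueValue p w (m + 1) (n :: queue) =
      p n * (w n + queueValue p w m queue) + (1 - p n) * queueValue p w m (n :: queue) := by
  simp [queueValue, transmit, expect_bind, expect_map, expect_coin, reward_cons_some, expect_add,
    expect_const]
  ring

lemma queueValue_le_succ (hw : ∀ n, 0 ≤ w n) (m : ℕ) (queue : List (Fin N)) :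
    queueValue p w m queue ≤ queueValue p w (m + 1) queue := by
  induction m generalizing queue with
  | zero =>
    rw [queueValue_zero]
    refine expect_nonneg fun log _ => Finset.sum_nonneg fun n _ => mul_nonneg (hw n) (by positivity)
  | succ m ih =>
    cases queue with
    | nil => simp [queueValue_nil]
    | cons n queue =>
      rw [queueValue_succ_cons, queueValue_succ_cons p (m + 1)]
      have h0 : (0 : ℝ) ≤ p n := (p n).2.1
      have h1 : (0 : ℝ) ≤ 1 - p n := sub_nonneg.2 (p n).2.2
      gcongr
      · exact ih queue
      · exact ih (n :: queue)

/-- The Bellman inequality for the queue sorted by decreasing `w n * p n`: serving any pending client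
`n` in the first slot, and following the sorted order afterwards, is not better than following the
sorted order throughout. If the head `b` of the queue is not `n`, then `b` is served in the second
slot, and the induction hypothesis allows the two services to be interchanged. -/
lemma le_queueValue_succ_of_sorted (m : ℕ) (queue : List (Fin N))
    (hs : queue.Pairwise fun a b => w b * p b ≤ w a * p a) (n : Fin N) (hn : n ∈ queue) :
    p n * (w n + queueValue p w m (queue.erase n)) + (1 - p n) * queueValue p w m queue ≤
      queueValue p w (m + 1) queue := by
  induction m generalizing queue with
  | zero =>
    cases queue with
    | nil => simp at hn
    | cons b queue =>
      rw [queueValue_succ_cons]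
      simp only [queueValue_zero]
      rcases List.mem_cons.1 hn with rfl | hn
      · exact le_rfl
      · have := (List.pairwise_cons.1 hs).1 n hn
        linarith
  | succ m ih =>
    cases queue with
    | nil => simp at hn
    | cons b queue =>
      by_cases hb : n = b
      · subst hb
        rw [queueValue_succ_cons p (m + 1), List.erase_cons_head]
      · have hn' : n ∈ queue := (List.mem_cons.1 hn).resolve_left hb
        have h1 := ih queue (List.pairwise_cons.1 hs).2 hn'
        have h2 := ih (b :: queue) hs hn
        rw [queueValue_succ_cons p (m + 1)]
        rw [List.erase_cons_tail (by simpa using Ne.symm hb)] at h2 ⊢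
        rw [queueValue_succ_cons p m b (queue.erase n)]
        have h3 := mul_le_mul_of_nonneg_left h1 (p b).2.1
        have h4 := mul_le_mul_of_nonneg_left h2 (sub_nonneg.2 (p b).2.2)
        have h5 := queueValue_succ_cons (w := w) p m b queue
        rw [h5] at h4 ⊢
        linarith

/-- A sorted queue is at least as good as any other queue, provided that it contains every client of
the latter that can earn a reward. -/
lemma queueValue_le_of_sorted (hw : ∀ n, 0 ≤ w n) (best : List (Fin N))
    (hs : best.Pairwise fun a b => w b * p b ≤ w a * p a) (m : ℕ) (queue : List (Fin N))
    (hq : queue.Nodup) (hsub : ∀ n ∈ queue, 0 < w n * p n → n ∈ best) :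
    queueValue p w m queue ≤ queueValue p w m best := by
  induction m generalizing best queue with
  | zero => simp [queueValue_zero]
  | succ m ih =>
    cases queue with
    | nil =>
      rw [queueValue_nil]
      exact expect_nonneg fun log _ =>
        Finset.sum_nonneg fun n _ => mul_nonneg (hw n) (by positivity)
    | cons n queue =>
      rw [queueValue_succ_cons]
      have hq' := List.nodup_cons.1 hq
      have h0 : (0 : ℝ) ≤ p n := (p n).2.1
      have h1 : (0 : ℝ) ≤ 1 - p n := sub_nonneg.2 (p n).2.2
      have h2 := mul_le_mul_of_nonneg_left (ih best hs (n :: queue) hq hsub) h1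
      by_cases hn : n ∈ best
      · refine le_trans ?_ (le_queueValue_succ_of_sorted p m best hs n hn)
        have h3 := mul_le_mul_of_nonneg_left (ih (best.erase n) (hs.sublist List.erase_sublist)
          queue hq'.2 fun a ha hpos => (List.mem_erase_of_ne (ne_of_mem_of_not_mem ha hq'.1)).2
            (hsub a (List.mem_cons_of_mem _ ha) hpos)) h0
        linarith
      · have h3 := mul_le_mul_of_nonneg_left (ih best hs queue hq'.2 fun a ha hpos =>
          hsub a (List.mem_cons_of_mem _ ha) hpos) h0
        have h4 : w n * p n ≤ 0 := not_lt.1 fun h => hn (hsub n List.mem_cons_self h)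
        have h5 := queueValue_le_succ p hw m best
        linarith

end transmit

/-! ### Optimality of the joint debt-channel ordering within a period -/

namespace System

variable {N : ℕ} {C X : Type*} (M : System N C X)

instance finSupp_periodLaw (c : C) (S : Finset (Fin N)) (l : PriorityOrder N) :
    FinSupp (M.periodLaw c S l) := by
  unfold periodLaw; infer_instance

instance : Finite (PriorityOrder N) := inferInstanceAs (Finite {l : List (Fin N) // l.Nodup})

instance : Nonempty (PriorityOrder N) := ⟨⟨[], List.nodup_nil⟩⟩

lemma length_of_mem_support_periodLaw {c : C} {S : Finset (Fin N)} {l : PriorityOrder N}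
    {log : List (Slot N)} (h : log ∈ (M.periodLaw c S l).support) : log.length = M.T := by
  simp only [periodLaw, PMF.support_map, Set.mem_image] at h
  obtain ⟨log, h, rfl⟩ := h
  have := M.τ_le_T
  simp [length_of_mem_support_transmit _ h]
  omega

lemma count_le_one_of_mem_support_periodLaw {c : C} {S : Finset (Fin N)} {l : PriorityOrder N}
    {log : List (Slot N)} (h : log ∈ (M.periodLaw c S l).support) (n : Fin N) :
    log.count (some (n, true)) ≤ 1 := by
  simp only [periodLaw, PMF.support_map, Set.mem_image] at h
  obtain ⟨log, h, rfl⟩ := h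
  have h1 := count_le_of_mem_support_transmit _ h n
  have h2 := List.nodup_iff_count_le_one.1 (l.2.filter (· ∈ S)) n
  simpa [List.count_replicate] using h1.trans h2

/-- The expected reward of a period with priority order `l`, when a delivery to client `n` is worth
`w n`. -/
noncomputable def orderValue (w : Fin N → ℝ) (c : C) (S : Finset (Fin N)) (l : PriorityOrder N) :
    ℝ :=
  expect (M.periodLaw c S l) (reward w)

/-- The largest expected reward of a period over all priority orders. -/
noncomputable def optValue (w : Fin N → ℝ) (c : C) (S : Finset (Fin N)) : ℝ :=
  ⨆ l : PriorityOrder N, M.orderValue w c S l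

lemma orderValue_le_optValue (w : Fin N → ℝ) (c : C) (S : Finset (Fin N)) (l : PriorityOrder N) :
    M.orderValue w c S l ≤ M.optValue w c S :=
  le_ciSup (Set.finite_range fun l => M.orderValue w c S l).bddAbove l

lemma orderValue_eq_queueValue (w : Fin N → ℝ) (c : C) (S : Finset (Fin N))
    (l : PriorityOrder N) :
    M.orderValue w c S l = queueValue (M.p c) w M.τ (l.1.filter (· ∈ S)) := by
  simp [orderValue, periodLaw, queueValue, expect_map, reward_append, reward_replicate_none]

lemma orderValue_eq_optValue {r : Fin N → ℝ} {c : C} {S : Finset (Fin N)} {l : PriorityOrder N}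
    (hl : M.IsJointDebtChannelOrder r c S l) :
    M.orderValue (fun n => max (r n) 0) c S l = M.optValue (fun n => max (r n) 0) c S := by
  refine le_antisymm (M.orderValue_le_optValue _ c S l) (ciSup_le fun l' => ?_)
  obtain ⟨h1, h2, h3⟩ := hl
  have hl : l.1.filter (· ∈ S) = l.1 := List.filter_eq_self.2 fun n hn => by simpa using (h1 n hn).1
  rw [orderValue_eq_queueValue, orderValue_eq_queueValue, hl]
  refine queueValue_le_of_sorted _ (fun n => le_max_right _ _) _ ?_ _ _ (l'.2.filter _) ?_
  · refine h3.imp_of_mem fun {a b} ha hb hab => ?_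
    rwa [max_eq_left (h1 a ha).2.le, max_eq_left (h1 b hb).2.le]
  · intro n hn hpos
    have hr : 0 < r n := by
      by_contra h
      simp [max_eq_right (not_lt.1 h)] at hpos
    rw [max_eq_left hr.le] at hpos
    exact h2 n (by simpa using (List.mem_filter.1 hn).2) hpos

lemma payoff_eq_expect (r : Fin N → ℝ) (c : C) (S : Finset (Fin N)) (D : PMF (PriorityOrder N)) :
    M.payoff r c S D = expect D (M.orderValue (fun n => max (r n) 0) c S) := by
  simp only [payoff, toReal_toOuterMeasure, ← expect_const_mul, ← expect_sum]
  rw [expect_bind]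
  refine expect_congr fun l _ => expect_congr fun log hlog => Finset.sum_congr rfl fun n _ => ?_
  have h1 := M.count_le_one_of_mem_support_periodLaw hlog n
  by_cases hn : some (n, true) ∈ log
  · have : log.count (some (n, true)) = 1 := le_antisymm h1 (List.count_pos_iff.2 hn)
    simp [hn, this]
  · simp [hn, List.count_eq_zero.2 hn]

lemma payoff_le_payoff {r : Fin N → ℝ} {c : C} {S : Finset (Fin N)} {D : PMF (PriorityOrder N)}
    (hD : ∀ l ∈ D.support, M.IsJointDebtChannelOrder r c S l) (D' : PMF (PriorityOrder N)) :
    M.payoff r c S D' ≤ M.payoff r c S D := by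
  rw [payoff_eq_expect, payoff_eq_expect]
  calc _ ≤ M.optValue (fun n => max (r n) 0) c S :=
        expect_le fun l _ => M.orderValue_le_optValue _ c S l
    _ ≤ _ := le_expect fun l hl => (M.orderValue_eq_optValue (hD l hl)).ge

lemma exists_isJointDebtChannelOrder (r : Fin N → ℝ) (c : C) (S : Finset (Fin N)) :
    ∃ l, M.IsJointDebtChannelOrder r c S l := by
  classical
  let rel : Fin N → Fin N → Prop := fun a b => r b * (M.p c b : ℝ) ≤ r a * (M.p c a : ℝ)
  have : Std.Total rel := ⟨fun a b => le_total _ _⟩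
  have : IsTrans (Fin N) rel := ⟨fun a b c h1 h2 => le_trans h2 h1⟩
  let l₀ := (S.filter fun n => 0 < r n).toList
  have hmem : ∀ n, n ∈ l₀.insertionSort rel ↔ n ∈ S ∧ 0 < r n := by simp [l₀]
  refine ⟨⟨l₀.insertionSort rel, (List.perm_insertionSort rel l₀).nodup_iff.2
    (Finset.nodup_toList _)⟩, fun n hn => (hmem n).1 hn, fun n hn hpos => (hmem n).2 ⟨hn, ?_⟩,
    List.pairwise_insertionSort rel l₀⟩
  exact pos_of_mul_pos_left hpos (M.p c n).2.1

lemma exists_isJointDebtChannelPolicy (q : Fin N → ℝ) :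
    ∃ η : PriorityPolicy N C X, M.IsJointDebtChannelPolicy q η := by
  choose l hl using fun (h : History N C X) (c : C) (x : X) =>
    M.exists_isJointDebtChannelOrder (M.deliveryDebt q h) c (M.arrivals x)
  refine ⟨fun h c x => PMF.pure (l h c x), fun h c x l' hl' => ?_⟩
  rw [PMF.support_pure, Set.mem_singleton_iff] at hl'
  exact hl' ▸ hl h c x

/-- The optimal reward depends on the weights in a Lipschitz way. -/
lemma optValue_le_add {w w' : Fin N → ℝ} {b : ℝ} (hb : ∀ n, |w' n - w n| ≤ b) (c : C)
    (S : Finset (Fin N)) : M.optValue w c S ≤ M.optValue w' c S + N * b * M.T := by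
  refine ciSup_le fun l => ?_
  refine le_trans ?_ (add_le_add_left (M.orderValue_le_optValue w' c S l) _)
  rw [orderValue, orderValue, ← expect_const (M.periodLaw c S l) (N * b * M.T), ← expect_add]
  refine expect_mono fun log hlog => ?_
  have : (N * b * M.T : ℝ) = ∑ _n : Fin N, b * M.T := by simp [mul_assoc]
  rw [reward, reward, this, ← Finset.sum_add_distrib]
  refine Finset.sum_le_sum fun n _ => ?_
  have h1 : (log.count (some (n, true)) : ℝ) ≤ M.T := by
    rw [← M.length_of_mem_support_periodLaw hlog]
    exact_mod_cast List.count_le_length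
  have h2 := (abs_le.1 (hb n)).1
  have h0 : 0 ≤ b := (abs_nonneg _).trans (hb n)
  have h3 : (0 : ℝ) ≤ log.count (some (n, true)) := by positivity
  nlinarith [mul_le_mul_of_nonneg_left h1 h0, mul_le_mul_of_nonneg_right h2 h3]

end System

/-! ### The law of the history, period by period -/

lemma StationaryChain.init_ne_zero {E : Type*} (P : StationaryChain E) (a : E) :
    P.init a ≠ 0 := by
  obtain ⟨b, hb⟩ := P.init.support_nonempty
  induction P.irreducible b a with
  | refl => exact hb
  | @tail y z _ hstep ih =>
    rw [← P.stationary, ← PMF.mem_support_iff, PMF.support_bind]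
    exact Set.mem_iUnion₂.2 ⟨y, ih, hstep⟩

namespace System

variable {N : ℕ} {C X : Type*} (M : System N C X)

/-- The law of the history after the current period, when its channel and arrival states are `c`
and `x` and `h` is the history before it. -/
noncomputable def periodStep (η : PriorityPolicy N C X) (h : History N C X) (c : C) (x : X) :
    PMF (History N C X) :=
  (η h c x).bind fun l => (M.periodLaw c (M.arrivals x) l).map fun log => ⟨c, x, l, log⟩ :: h

/-- The law of the history one period after the history `h`. -/
noncomputable def nextHistory (η : PriorityPolicy N C X) (h : History N C X) :
    PMF (History N C X) :=
  (M.nextChannel h).bind fun c => (M.nextArrival h).bind fun x => M.periodStep η h c x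

/-- The law of the history `k` periods after the history `h`. -/
noncomputable def run (η : PriorityPolicy N C X) : ℕ → History N C X → PMF (History N C X)
  | 0, h => PMF.pure h
  | k + 1, h => (M.nextHistory η h).bind (run η k)

lemma law_succ (η : PriorityPolicy N C X) (k : ℕ) :
    M.law η (k + 1) = (M.law η k).bind (M.nextHistory η) := rfl

lemma law_add (η : PriorityPolicy N C X) (j k : ℕ) :
    M.law η (j + k) = (M.law η j).bind (M.run η k) := by
  induction k generalizing j with
  | zero =>
    have : M.run η 0 = PMF.pure := rfl
    rw [this, PMF.bind_pure, add_zero]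
  | succ k ih =>
    have : M.run η (k + 1) = fun h => (M.nextHistory η h).bind (M.run η k) := rfl
    rw [this, ← PMF.bind_bind, ← law_succ, ← ih, add_right_comm, add_assoc]

/-- Conditioning on the channel and arrival states of the first period. -/
lemma law_succ_eq_bind_init (η : PriorityPolicy N C X) (k : ℕ) :
    M.law η (k + 1) = M.channel.init.bind fun c => M.arrival.init.bind fun x =>
      (M.periodStep η [] c x).bind (M.run η k) := by
  have h1 : M.law η 0 = PMF.pure [] := rfl
  have h2 : M.run η (k + 1) [] = (M.nextHistory η []).bind (M.run η k) := rfl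
  rw [← zero_add (k + 1), law_add, h1, PMF.pure_bind, h2]
  simp only [nextHistory, PMF.bind_bind]
  rfl

instance finSupp_periodStep (η : PriorityPolicy N C X) (h : History N C X) (c : C) (x : X) :
    FinSupp (M.periodStep η h c x) := by
  unfold periodStep; infer_instance

lemma mem_support_periodStep {η : PriorityPolicy N C X} {h h' : History N C X} {c : C} {x : X} :
    h' ∈ (M.periodStep η h c x).support ↔
      ∃ l ∈ (η h c x).support, ∃ log ∈ (M.periodLaw c (M.arrivals x) l).support,
        ⟨c, x, l, log⟩ :: h = h' := by
  simp [periodStep, PMF.support_bind, PMF.support_map]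

lemma expect_periodStep (η : PriorityPolicy N C X) (h : History N C X) (c : C) (x : X)
    (f : History N C X → ℝ) :
    expect (M.periodStep η h c x) f = expect (η h c x) fun l =>
      expect (M.periodLaw c (M.arrivals x) l) fun log => f (⟨c, x, l, log⟩ :: h) := by
  simp only [periodStep, expect_bind, expect_map]

/-- In every period of the history all slots are recorded. -/
def Complete (h : History N C X) : Prop := ∀ r ∈ h, r.slots.length = M.T

lemma mem_support_nextHistory {η : PriorityPolicy N C X} {h h' : History N C X}
    (hh' : h' ∈ (M.nextHistory η h).support) :
    ∃ r : PeriodRecord N C X, h' = r :: h ∧ r.slots.length = M.T := by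
  simp only [nextHistory, PMF.support_bind, Set.mem_iUnion, mem_support_periodStep] at hh'
  obtain ⟨c, -, x, -, l, -, log, hlog, rfl⟩ := hh'
  exact ⟨_, rfl, M.length_of_mem_support_periodLaw hlog⟩

variable {M} in
lemma Complete.cons {h : History N C X} (hh : M.Complete h) {r : PeriodRecord N C X}
    (hr : r.slots.length = M.T) : M.Complete (r :: h) :=
  List.forall_mem_cons.2 ⟨hr, hh⟩

lemma complete_of_mem_support_law {η : PriorityPolicy N C X} {k : ℕ} {h : History N C X}
    (hh : h ∈ (M.law η k).support) : M.Complete h ∧ h.length = k := by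
  induction k generalizing h with
  | zero =>
    have : h = [] := by simpa [law, PMF.support_pure] using hh
    subst this
    exact ⟨by simp [Complete], rfl⟩
  | succ k ih =>
    rw [law_succ, PMF.support_bind] at hh
    simp only [Set.mem_iUnion] at hh
    obtain ⟨h₀, hh₀, hh⟩ := hh
    obtain ⟨r, rfl, hr⟩ := M.mem_support_nextHistory hh
    obtain ⟨h1, h2⟩ := ih hh₀
    exact ⟨h1.cons hr, by simp [h2]⟩

variable {M} in
lemma Complete.length_slotLog {h : History N C X} (hh : M.Complete h) :
    (slotLog h).length = h.length * M.T := by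
  induction h with
  | nil => simp [slotLog]
  | cons r h ih =>
    obtain ⟨h1, h2⟩ := List.forall_mem_cons.1 hh
    rw [slotLog, List.length_append, ih h2, h1, List.length_cons]
    ring

variable {M} in
lemma Complete.deliveryDebt_eq {h : History N C X} (hh : M.Complete h) (q : Fin N → ℝ)
    (n : Fin N) :
    M.deliveryDebt q h n = q n * h.length - (slotLog h).count (some (n, true)) := by
  rw [deliveryDebt, deliveredBy, List.take_of_length_le hh.length_slotLog.le]

variable {M} in
lemma Complete.deliveryDebt_cons {h : History N C X} (hh : M.Complete h) {r : PeriodRecord N C X}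
    (hr : r.slots.length = M.T) (q : Fin N → ℝ) (n : Fin N) :
    M.deliveryDebt q (r :: h) n =
      M.deliveryDebt q h n + q n - r.slots.count (some (n, true)) := by
  rw [(hh.cons hr).deliveryDebt_eq, hh.deliveryDebt_eq, slotLog, List.count_append,
    List.length_cons]
  push_cast
  ring

/-! ### The largest reward in several consecutive periods -/

/-- The largest expected reward in `k` consecutive periods, the first of which has channel state `c`
and arrival state `x`, when a delivery to client `n` is worth `w n`. Priorities influence neither the
channel nor the arrivals, so each period is optimised by itself. -/
noncomputable def optTotal (w : Fin N → ℝ) : ℕ → C → X → ℝ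
  | 0, _, _ => 0
  | k + 1, c, x => M.optValue w c (M.arrivals x) +
      expect (M.channel.step c) fun c' => expect (M.arrival.step x) fun x' => optTotal w k c' x'

/-- The conditional expectation, given the history `h`, of a function of the channel and arrival
states of the next period. -/
noncomputable def expectNext (h : History N C X) (f : C → X → ℝ) : ℝ :=
  expect (M.nextChannel h) fun c => expect (M.nextArrival h) fun x => f c x

lemma optTotal_succ (w : Fin N → ℝ) (k : ℕ) (r : PeriodRecord N C X) (h : History N C X) :
    M.optTotal w (k + 1) r.chan r.arr =
      M.optValue w r.chan (M.arrivals r.arr) + M.expectNext (r :: h) (M.optTotal w k) := rfl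

lemma expect_periodStep_optTotal (η : PriorityPolicy N C X) (h : History N C X) (c : C) (x : X)
    (w : Fin N → ℝ) (k : ℕ) :
    expect (M.periodStep η h c x) (fun h' => M.expectNext h' (M.optTotal w k)) =
      M.optTotal w (k + 1) c x - M.optValue w c (M.arrivals x) := by
  have : ∀ h' ∈ (M.periodStep η h c x).support, M.expectNext h' (M.optTotal w k) =
      M.optTotal w (k + 1) c x - M.optValue w c (M.arrivals x) := by
    intro h' hh'
    obtain ⟨l, -, log, -, rfl⟩ := M.mem_support_periodStep.1 hh'
    rw [M.optTotal_succ w k ⟨c, x, l, log⟩ h]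
    ring
  rw [expect_congr this, expect_const]

lemma expect_periodStep_reward_add (η : PriorityPolicy N C X) (h : History N C X) (c : C) (x : X)
    (w : Fin N → ℝ) (k : ℕ) :
    expect (M.periodStep η h c x)
        (fun h' => reward w (slotLog h') + M.expectNext h' (M.optTotal w k)) ≤
      reward w (slotLog h) + M.optTotal w (k + 1) c x := by
  have h1 : expect (M.periodStep η h c x) (fun h' => reward w (slotLog h')) ≤
      reward w (slotLog h) + M.optValue w c (M.arrivals x) := by
    rw [expect_periodStep]
    refine expect_le fun l _ => ?_
    simp only [slotLog, reward_append, expect_add, expect_const]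
    exact add_le_add_right (M.orderValue_le_optValue w c _ l) _
  rw [expect_add, expect_periodStep_optTotal]
  linarith

variable [Finite C] [Finite X]

instance finSupp_nextHistory (η : PriorityPolicy N C X) (h : History N C X) :
    FinSupp (M.nextHistory η h) := by
  unfold nextHistory; infer_instance

instance finSupp_run (η : PriorityPolicy N C X) (k : ℕ) (h : History N C X) :
    FinSupp (M.run η k h) := by
  induction k generalizing h with
  | zero => unfold run; infer_instance
  | succ k ih => unfold run; infer_instance

instance finSupp_law (η : PriorityPolicy N C X) (k : ℕ) : FinSupp (M.law η k) := by
  induction k with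
  | zero => unfold law; infer_instance
  | succ k ih => rw [law_succ]; infer_instance

lemma expect_nextHistory (η : PriorityPolicy N C X) (h : History N C X)
    (f : History N C X → ℝ) :
    expect (M.nextHistory η h) f = M.expectNext h fun c x => expect (M.periodStep η h c x) f := by
  simp only [nextHistory, expect_bind, expectNext]

lemma expectNext_mono (h : History N C X) {f g : C → X → ℝ} (hfg : ∀ c x, f c x ≤ g c x) :
    M.expectNext h f ≤ M.expectNext h g :=
  expect_mono fun c _ => expect_mono fun x _ => hfg c x

lemma expectNext_add (h : History N C X) (f g : C → X → ℝ) :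
    M.expectNext h (fun c x => f c x + g c x) = M.expectNext h f + M.expectNext h g := by
  simp only [expectNext, expect_add]

lemma expectNext_const (h : History N C X) (a : ℝ) : M.expectNext h (fun _ _ => a) = a := by
  simp only [expectNext, expect_const]

lemma expectNext_const_mul (h : History N C X) (a : ℝ) (f : C → X → ℝ) :
    M.expectNext h (fun c x => a * f c x) = a * M.expectNext h f := by
  simp only [expectNext, expect_const_mul]

/-- No policy earns more than the largest total reward. -/
lemma expect_run_reward_le (η : PriorityPolicy N C X) (w : Fin N → ℝ) (k : ℕ)
    (h : History N C X) :
    expect (M.run η k h) (fun h' => reward w (slotLog h')) ≤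
      reward w (slotLog h) + M.expectNext h (M.optTotal w k) := by
  induction k generalizing h with
  | zero =>
    have : M.optTotal w 0 = fun _ _ => 0 := rfl
    rw [run, expect_pure, this, expectNext_const, add_zero]
  | succ k ih =>
    rw [run, expect_bind]
    refine (expect_mono fun h' _ => ih h').trans ?_
    rw [expect_nextHistory]
    refine (M.expectNext_mono h fun c x => M.expect_periodStep_reward_add η h c x w k).trans ?_
    rw [expectNext_add, expectNext_const]

lemma expect_reward_le_optTotal (η : PriorityPolicy N C X) (w : Fin N → ℝ) (k : ℕ) (c : C)
    (x : X) :
    expect ((M.periodStep η [] c x).bind (M.run η k)) (fun h => reward w (slotLog h)) ≤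
      M.optTotal w (k + 1) c x := by
  rw [expect_bind]
  refine (expect_mono fun h _ => M.expect_run_reward_le η w k h).trans ?_
  simpa [slotLog, reward_nil] using M.expect_periodStep_reward_add η [] c x w k

/-! ### Feasible requirements are dominated by the largest reward, from every initial state -/

/-- If an event has probability tending to `1`, then it also does given the channel and arrival
states of the first period. -/
lemma tendsto_prob_given_init (η : PriorityPolicy N C X) (s : ℕ → Set (History N C X))
    (hs : Filter.Tendsto (fun k => (M.law η (k + 1)).toOuterMeasure (s k)) Filter.atTop (nhds 1))
    (c : C) (x : X) :
    Filter.Tendsto (fun k => expect ((M.periodStep η [] c x).bind (M.run η k))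
      ((s k).indicator 1)) Filter.atTop (nhds 1) := by
  set f : ℕ → C → X → ℝ := fun k c x =>
    expect ((M.periodStep η [] c x).bind (M.run η k)) ((s k).indicator 1) with hf
  have hle : ∀ k c x, f k c x ≤ 1 := fun k c x => expect_le fun h _ =>
    Set.indicator_le_self' (by simp) h
  set a : ℝ := (M.channel.init c).toReal * (M.arrival.init x).toReal with ha
  have hpos : 0 < a := mul_pos
    (ENNReal.toReal_pos (StationaryChain.init_ne_zero _ c) (PMF.apply_ne_top _ _))
    (ENNReal.toReal_pos (StationaryChain.init_ne_zero _ x) (PMF.apply_ne_top _ _))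
  have hreal : Filter.Tendsto (fun k => ((M.law η (k + 1)).toOuterMeasure (s k)).toReal)
      Filter.atTop (nhds 1) := by
    simpa only [ENNReal.toReal_one, Function.comp_def] using
      (ENNReal.tendsto_toReal ENNReal.one_ne_top).comp hs
  have hbound : ∀ k, 1 - (1 - ((M.law η (k + 1)).toOuterMeasure (s k)).toReal) / a ≤ f k c x := by
    intro k
    have h1 : 1 - ((M.law η (k + 1)).toOuterMeasure (s k)).toReal =
        expect M.channel.init fun c => expect M.arrival.init fun x => (1 + (-1) * f k c x) := by
      rw [toReal_toOuterMeasure, law_succ_eq_bind_init]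
      simp only [expect_bind (M.channel.init), expect_bind (M.arrival.init), expect_add,
        expect_const_mul, expect_const, hf]
      ring
    have h2 := toReal_mul_le_expect M.channel.init
      (f := fun c => expect M.arrival.init fun x => (1 + (-1) * f k c x))
      (fun c => expect_nonneg fun x _ => by linarith [hle k c x]) c
    have h3 := toReal_mul_le_expect M.arrival.init
      (f := fun x => (1 + (-1) * f k c x)) (fun x => by linarith [hle k c x]) x
    have h4 := mul_le_mul_of_nonneg_left h3 (ENNReal.toReal_nonneg (a := M.channel.init c))
    have h5 : a * (1 - f k c x) ≤ 1 - ((M.law η (k + 1)).toOuterMeasure (s k)).toReal := by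
      rw [h1, ha]; linarith
    rw [sub_le_comm, le_div_iff₀ hpos]
    linarith
  refine tendsto_of_tendsto_of_tendsto_of_le_of_le ?_ tendsto_const_nhds hbound
    (fun k => hle k c x)
  simpa using ((hreal.const_sub 1).div_const a).const_sub 1

/-- Strictly feasible requirements `q` are dominated, in a suitable number `m` of periods, by the
largest reward, simultaneously for all weights and all initial states. -/
lemma exists_le_optTotal {q : Fin N → ℝ} (hq : ∀ n, 0 < q n) (hfeas : M.StrictlyFeasible q) :
    ∃ m : ℕ, 0 < m ∧ ∀ w : Fin N → ℝ, (∀ n, 0 ≤ w n) → ∀ c x,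
      m * ∑ n, w n * q n ≤ M.optTotal w m c x := by
  obtain ⟨α, hα0, hα1, η, hη⟩ := hfeas
  obtain ⟨ε, hε, hεq⟩ : ∃ ε : ℝ, 0 < ε ∧ ∀ n, q n + ε ≤ q n / α - ε := by
    have h : ∀ n, ∀ᶠ ε in nhdsWithin (0 : ℝ) (Set.Ioi 0), q n + ε ≤ q n / α - ε := by
      intro n
      have h1 : 0 < q n / α - q n := by
        rw [sub_pos, lt_div_iff₀ hα0]
        nlinarith [hq n]
      filter_upwards [Ioo_mem_nhdsGT (half_pos h1)] with ε hε
      linarith [hε.2]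
    obtain ⟨ε, h1, h2⟩ := ((Filter.eventually_all.2 h).and self_mem_nhdsWithin).exists
    exact ⟨ε, h2, h1⟩
  have hT : 0 < M.T := M.T_pos
  have hT' : (0 : ℝ) < M.T := Nat.cast_pos.2 hT
  set s : ℕ → Set (History N C X) := fun k =>
    {h | ∀ n, q n / α - ε < (deliveredBy h n (k * M.T) : ℝ) / (((k * M.T : ℕ) : ℝ) / (M.T : ℝ))}
    with hs_def
  have hs : Filter.Tendsto (fun k => (M.law η (k + 1)).toOuterMeasure (s k)) Filter.atTop
      (nhds 1) := by
    have h1 : Filter.Tendsto (fun k : ℕ => k * M.T) Filter.atTop Filter.atTop :=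
      Filter.tendsto_atTop_mono (fun k => Nat.le_mul_of_pos_right k hT) Filter.tendsto_id
    have h2 := (hη ε hε).comp h1
    simpa only [Function.comp_def, Nat.mul_div_cancel _ hT] using h2
  set P : ℕ → C → X → ℝ := fun k c x =>
    expect ((M.periodStep η [] c x).bind (M.run η k)) ((s k).indicator 1) with hP_def
  have hlim : ∀ c x n, ∀ᶠ k : ℕ in Filter.atTop,
      (k + 1 : ℕ) * q n ≤ k * (q n + ε) * P k c x := by
    intro c x n
    have h1 := M.tendsto_prob_given_init η s hs c x
    have h2 : Filter.Tendsto (fun k => (q n + ε) * P k c x - q n) Filter.atTop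
        (nhds ((q n + ε) * 1 - q n)) := (h1.const_mul _).sub_const _
    have h3 : ε / 2 < (q n + ε) * 1 - q n := by linarith
    have h4 := (tendsto_natCast_atTop_atTop (R := ℝ)).eventually_ge_atTop (q n / (ε / 2))
    filter_upwards [h2.eventually_const_lt h3, h4] with k h5 h6
    rw [div_le_iff₀ (half_pos hε)] at h6
    have h7 := mul_le_mul_of_nonneg_left h5.le (Nat.cast_nonneg (α := ℝ) k)
    push_cast
    linarith
  have hall : ∀ᶠ k : ℕ in Filter.atTop, ∀ c x n, (k + 1 : ℕ) * q n ≤ k * (q n + ε) * P k c x :=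
    Filter.eventually_all.2 fun c => Filter.eventually_all.2 fun x =>
      Filter.eventually_all.2 fun n => hlim c x n
  obtain ⟨k, hk, hk1⟩ := (hall.and (Filter.eventually_gt_atTop 0)).exists
  refine ⟨k + 1, k.succ_pos, fun w hw c x => le_trans ?_ (M.expect_reward_le_optTotal η w k c x)⟩
  have hk1' : (0 : ℝ) < k := Nat.cast_pos.2 hk1
  calc ((k + 1 : ℕ) : ℝ) * ∑ n, w n * q n
      ≤ (∑ n, w n * (k * (q n + ε))) * P k c x := by
        rw [Finset.mul_sum, Finset.sum_mul]
        refine Finset.sum_le_sum fun n _ => ?_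
        have := mul_le_mul_of_nonneg_left (hk c x n) (hw n)
        linarith
    _ ≤ _ := by
        rw [hP_def, ← expect_const_mul]
        refine expect_mono fun h _ => ?_
        by_cases hh : h ∈ s k
        · simp only [Set.indicator_of_mem hh, Pi.one_apply, mul_one]
          refine Finset.sum_le_sum fun n _ => mul_le_mul_of_nonneg_left ?_ (hw n)
          have h1 := hh n
          rw [Nat.cast_mul, mul_div_cancel_right₀ _ hT'.ne', lt_div_iff₀ hk1'] at h1
          have h2 : (deliveredBy h n (k * M.T) : ℝ) ≤ (slotLog h).count (some (n, true)) :=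
            Nat.cast_le.2 ((List.take_sublist _ _).count_le _)
          have h3 := mul_le_mul_of_nonneg_right (hεq n) hk1'.le
          linarith
        · simp only [Set.indicator_of_notMem hh, mul_zero]
          exact Finset.sum_nonneg fun n _ => mul_nonneg (hw n) (Nat.cast_nonneg _)

end System

/-! ### Quadratic drift of the delivery debts -/

lemma sq_max_zero_add_sub_le {r q μ a : ℝ} (h : |q - μ| ≤ a) :
    max (r + q - μ) 0 ^ 2 + 2 * (max r 0 * μ) ≤ max r 0 ^ 2 + a ^ 2 + 2 * (max r 0 * q) := by
  have h1 : (q - μ) ^ 2 ≤ a ^ 2 := sq_le_sq' (abs_le.1 h).1 (abs_le.1 h).2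
  have h2 : max (r + q - μ) 0 ^ 2 ≤ (max r 0 + (q - μ)) ^ 2 := by
    rcases le_total (r + q - μ) 0 with hneg | hpos
    · rw [max_eq_right hneg, zero_pow two_ne_zero]
      exact sq_nonneg _
    · rw [max_eq_left hpos]
      exact pow_le_pow_left₀ hpos (by linarith [le_max_left r 0]) 2
  nlinarith

namespace System

variable {N : ℕ} {C X : Type*} (M : System N C X)

/-- The positive parts of the delivery debts. -/
noncomputable def posDebt (q : Fin N → ℝ) (h : History N C X) (n : Fin N) : ℝ :=
  max (M.deliveryDebt q h n) 0

/-- The Lyapunov function: the sum of the squares of the positive parts of the delivery debts. -/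
noncomputable def lyapunov (q : Fin N → ℝ) (h : History N C X) : ℝ :=
  ∑ n, M.posDebt q h n ^ 2

/-- A bound on the change of a delivery debt during one period. -/
noncomputable def debtStep (q : Fin N → ℝ) : ℝ := ∑ n, q n + M.T

variable {M} {q : Fin N → ℝ} (hq : ∀ n, 0 < q n)

include hq

lemma debtStep_nonneg : 0 ≤ M.debtStep q :=
  add_nonneg (Finset.sum_nonneg fun n _ => (hq n).le) (Nat.cast_nonneg _)

lemma le_debtStep (n : Fin N) : q n ≤ M.debtStep q := by
  have h1 := Finset.single_le_sum (f := q) (fun n _ => (hq n).le) (Finset.mem_univ n)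
  have h2 : (0 : ℝ) ≤ M.T := Nat.cast_nonneg _
  rw [debtStep]
  linarith

lemma natCast_T_le_debtStep : (M.T : ℝ) ≤ M.debtStep q :=
  le_add_of_nonneg_left (Finset.sum_nonneg fun n _ => (hq n).le)

lemma abs_sub_count_le {log : List (Slot N)} (hlog : log.length = M.T) (n : Fin N) :
    |q n - log.count (some (n, true))| ≤ M.debtStep q := by
  have h1 : (log.count (some (n, true)) : ℝ) ≤ M.T := by
    rw [← hlog]
    exact_mod_cast List.count_le_length
  have h2 : (0 : ℝ) ≤ log.count (some (n, true)) := Nat.cast_nonneg _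
  rw [abs_le]
  constructor <;> linarith [hq n, le_debtStep (M := M) hq n, natCast_T_le_debtStep (M := M) hq]

lemma lyapunov_cons_add_le {h : History N C X} (hh : M.Complete h) {r : PeriodRecord N C X}
    (hr : r.slots.length = M.T) :
    M.lyapunov q (r :: h) + 2 * reward (M.posDebt q h) r.slots ≤
      M.lyapunov q h + N * M.debtStep q ^ 2 + 2 * ∑ n, M.posDebt q h n * q n := by
  have : N * M.debtStep q ^ 2 = ∑ _n : Fin N, M.debtStep q ^ 2 := by simp
  rw [lyapunov, lyapunov, reward, this, Finset.mul_sum, Finset.mul_sum, ← Finset.sum_add_distrib,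
    ← Finset.sum_add_distrib, ← Finset.sum_add_distrib]
  refine Finset.sum_le_sum fun n _ => ?_
  rw [posDebt, hh.deliveryDebt_cons hr]
  exact sq_max_zero_add_sub_le (abs_sub_count_le hq hr n)

lemma abs_posDebt_cons_sub_le {h : History N C X} (hh : M.Complete h) {r : PeriodRecord N C X}
    (hr : r.slots.length = M.T) (n : Fin N) :
    |M.posDebt q (r :: h) n - M.posDebt q h n| ≤ M.debtStep q := by
  refine (abs_max_sub_max_le_abs _ _ 0).trans ?_
  rw [hh.deliveryDebt_cons hr, add_sub_assoc, add_sub_cancel_left]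
  exact abs_sub_count_le hq hr n

/-- The drift in one period under a joint debt-channel policy: the order used is optimal for the
current debts, hence nearly optimal for weights `w` that are close to them. -/
lemma expect_periodStep_lyapunov_add_le {η : PriorityPolicy N C X}
    (hη : M.IsJointDebtChannelPolicy q η) {h : History N C X} (hh : M.Complete h)
    {w : Fin N → ℝ} {b : ℝ} (hb : 0 ≤ b) (hw : ∀ n, |M.posDebt q h n - w n| ≤ b) (c : C) (x : X) :
    expect (M.periodStep η h c x) (M.lyapunov q) + 2 * M.optValue w c (M.arrivals x) ≤
      M.lyapunov q h + (2 * ∑ n, w n * q n + N * M.debtStep q ^ 2 + 4 * N * M.debtStep q * b) := by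
  set a := M.debtStep q with ha
  have hq_sum : ∑ n, M.posDebt q h n * q n ≤ ∑ n, w n * q n + N * b * a := by
    have : N * b * a = ∑ _n : Fin N, b * a := by simp [mul_assoc]
    rw [this, ← Finset.sum_add_distrib]
    refine Finset.sum_le_sum fun n _ => ?_
    have h1 := mul_le_mul_of_nonneg_right (abs_le.1 (hw n)).2 (hq n).le
    have h2 := mul_le_mul_of_nonneg_left (le_debtStep (M := M) hq n) hb
    linarith
  have hopt := M.optValue_le_add hw c (M.arrivals x)
  have hT : (N * b * M.T : ℝ) ≤ N * b * a :=
    mul_le_mul_of_nonneg_left (natCast_T_le_debtStep hq) (by positivity)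
  have hmain : expect (M.periodStep η h c x) (M.lyapunov q) +
      2 * M.optValue (M.posDebt q h) c (M.arrivals x) ≤
      M.lyapunov q h + N * a ^ 2 + 2 * ∑ n, M.posDebt q h n * q n := by
    rw [expect_periodStep, ← expect_const (η h c x) (2 * M.optValue _ _ _), ← expect_add]
    refine expect_le fun l hl => ?_
    have h1 : M.orderValue (M.posDebt q h) c (M.arrivals x) l =
        M.optValue (M.posDebt q h) c (M.arrivals x) := M.orderValue_eq_optValue (hη h c x l hl)
    rw [← h1, orderValue, ← expect_const_mul, ← expect_add]
    exact expect_le fun log hlog => lyapunov_cons_add_le hq (r := ⟨c, x, l, log⟩) hh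
      (M.length_of_mem_support_periodLaw hlog)
  linarith

variable [Finite C] [Finite X]

/-- The drift in `m` periods, compared with the largest reward in these periods for weights `w` that
are close to the debts at the beginning. -/
lemma expect_run_lyapunov_add_le {η : PriorityPolicy N C X}
    (hη : M.IsJointDebtChannelPolicy q η) {w : Fin N → ℝ} (m : ℕ) {h : History N C X}
    (hh : M.Complete h) {b : ℝ} (hb : 0 ≤ b) (hw : ∀ n, |M.posDebt q h n - w n| ≤ b) :
    expect (M.run η m h) (M.lyapunov q) + 2 * M.expectNext h (M.optTotal w m) ≤
      M.lyapunov q h + m * (2 * ∑ n, w n * q n + N * M.debtStep q ^ 2 +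
        4 * N * M.debtStep q * (b + m * M.debtStep q)) := by
  set a := M.debtStep q with ha_def
  have ha : 0 ≤ a := debtStep_nonneg hq
  induction m generalizing h b with
  | zero =>
    have : M.optTotal w 0 = fun _ _ => 0 := rfl
    rw [run, expect_pure, this, expectNext_const]
    simp
  | succ m ih =>
    set B := 2 * ∑ n, w n * q n + N * a ^ 2 + 4 * N * a * (b + (m + 1) * a) with hB
    have h1 : expect (M.nextHistory η h) (fun h' => expect (M.run η m h') (M.lyapunov q)) ≤
        expect (M.nextHistory η h) (fun h' => M.lyapunov q h' +
          (-2) * M.expectNext h' (M.optTotal w m)) + m * B := by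
      rw [← expect_const (M.nextHistory η h) (m * B), ← expect_add]
      refine expect_mono fun h' hh' => ?_
      obtain ⟨r, rfl, hr⟩ := M.mem_support_nextHistory hh'
      have h2 := ih (hh.cons hr) (b := b + a) (add_nonneg hb ha) fun n =>
        (abs_sub_le _ (M.posDebt q h n) _).trans
          (by linarith [abs_posDebt_cons_sub_le hq hh hr n, hw n])
      have h3 : b + a + m * a = b + (m + 1) * a := by ring
      rw [h3] at h2
      linarith
    have h2 : expect (M.nextHistory η h) (fun h' => M.lyapunov q h' +
          (-2) * M.expectNext h' (M.optTotal w m)) ≤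
        M.expectNext h fun c x => (M.lyapunov q h + B) + (-2) * M.optTotal w (m + 1) c x := by
      rw [expect_nextHistory]
      refine M.expectNext_mono h fun c x => ?_
      rw [expect_add, expect_const_mul, expect_periodStep_optTotal]
      have h3 := expect_periodStep_lyapunov_add_le hq hη hh hb hw c x
      have h4 : 4 * N * a * b ≤ 4 * N * a * (b + (m + 1) * a) := by
        refine mul_le_mul_of_nonneg_left ?_ (by positivity)
        have : 0 ≤ (m + 1) * a := by positivity
        linarith
      linarith
    rw [expectNext_add, expectNext_const, expectNext_const_mul] at h2
    rw [run, expect_bind]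
    push_cast
    linarith

/-- Under a joint debt-channel policy the Lyapunov function grows at most linearly in expectation. -/
lemma exists_expect_lyapunov_le {η : PriorityPolicy N C X} (hη : M.IsJointDebtChannelPolicy q η)
    {m : ℕ} (hm : 0 < m) (hopt : ∀ w : Fin N → ℝ, (∀ n, 0 ≤ w n) → ∀ c x,
      m * ∑ n, w n * q n ≤ M.optTotal w m c x) :
    ∃ A B : ℝ, ∀ k : ℕ, expect (M.law η k) (M.lyapunov q) ≤ A + k * B := by
  set a := M.debtStep q with ha_def
  have ha : 0 ≤ a := debtStep_nonneg hq
  set B := N * a ^ 2 + 4 * N * a * (m * a) with hB_def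
  have hB : 0 ≤ B := by positivity
  refine ⟨N * (a * m) ^ 2, B, fun k => ?_⟩
  induction k using Nat.strong_induction_on with
  | _ k ih =>
    rcases lt_or_ge k m with hk | hk
    · refine expect_le fun h hh => ?_
      have h1 : M.lyapunov q h ≤ ∑ _n : Fin N, (a * m) ^ 2 := by
        refine Finset.sum_le_sum fun n _ => pow_le_pow_left₀ (le_max_right _ _) ?_ 2
        refine max_le ?_ (by positivity)
        have h2 : (0 : ℝ) ≤ deliveredBy h n (h.length * M.T) := Nat.cast_nonneg _
        have h3 : q n * h.length ≤ a * m := by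
          rw [(M.complete_of_mem_support_law hh).2]
          exact mul_le_mul (le_debtStep hq n) (Nat.cast_le.2 hk.le) (Nat.cast_nonneg _) ha
        rw [deliveryDebt]
        linarith
      have h4 : 0 ≤ k * B := by positivity
      simp only [Finset.sum_const, Finset.card_univ, Fintype.card_fin, nsmul_eq_mul] at h1
      linarith
    · obtain ⟨j, rfl⟩ := Nat.exists_eq_add_of_le' hk
      have hdrift : expect (M.law η (j + m)) (M.lyapunov q) ≤
          expect (M.law η j) (M.lyapunov q) + m * B := by
        rw [law_add, expect_bind, ← expect_const (M.law η j) (m * B), ← expect_add]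
        refine expect_mono fun h hh => ?_
        have h1 := expect_run_lyapunov_add_le hq hη (w := M.posDebt q h) m
          (M.complete_of_mem_support_law hh).1 le_rfl (fun n => by simp)
        have h2 : m * ∑ n, M.posDebt q h n * q n ≤
            M.expectNext h (M.optTotal (M.posDebt q h) m) := by
          rw [← M.expectNext_const h (m * ∑ n, M.posDebt q h n * q n)]
          exact M.expectNext_mono h fun c x => hopt _ (fun n => le_max_right _ _) c x
        rw [zero_add] at h1
        linarith
      have := ih j (by omega)
      push_cast
      linarith

end System

/-! ### From the Lyapunov bound to the fulfilment of the requirements -/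

namespace System

variable {N : ℕ} {C X : Type*} {M : System N C X} {q : Fin N → ℝ} (hq : ∀ n, 0 < q n)

include hq

/-- If the debts after the `t / T` periods of `h` are small, then the requirements are met, up to `ε`,
at time `t`, which lies in the following period. -/
lemma lt_deliveredBy_div {ε : ℝ} (hε : 0 < ε) {h : History N C X} (hh : M.Complete h)
    {r : PeriodRecord N C X} {t : ℕ} (hlen : h.length = t / M.T) (hpos : 0 < t / M.T) (n : Fin N)
    (hlarge : q n ≤ ε / 2 * (t / M.T : ℕ)) (hdebt : M.posDebt q h n < ε / 2 * (t / M.T : ℕ)) :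
    q n - ε < (deliveredBy (r :: h) n t : ℝ) / ((t : ℝ) / (M.T : ℝ)) := by
  have hT : (0 : ℝ) < M.T := Nat.cast_pos.2 M.T_pos
  set k := t / M.T
  have hkt : k * M.T ≤ t := Nat.div_mul_le_self t M.T
  have h1 : (k : ℝ) ≤ t / M.T := by
    rw [le_div_iff₀ hT]
    exact_mod_cast hkt
  have h2 : (t : ℝ) / M.T ≤ k + 1 := by
    rw [div_le_iff₀ hT]
    have h6 : t < M.T * (k + 1) := Nat.lt_mul_div_succ t M.T_pos
    rw [mul_comm] at h6
    exact_mod_cast h6.le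
  have h3 : (deliveredBy h n (h.length * M.T) : ℝ) ≤ deliveredBy (r :: h) n t := by
    refine Nat.cast_le.2 (List.Sublist.count_le _ ?_)
    have h4 : (slotLog h).take (h.length * M.T) = (slotLog (r :: h)).take (h.length * M.T) := by
      rw [slotLog, List.take_append_of_le_length hh.length_slotLog.ge]
    rw [h4, hlen]
    exact (List.take_prefix_take_left hkt).sublist
  have h4 := (le_max_left _ _).trans_lt hdebt
  rw [deliveryDebt] at h4
  have hlen' : (h.length : ℝ) = k := by rw [hlen]
  rw [hlen'] at h4
  have hk : (0 : ℝ) < k := Nat.cast_pos.2 hpos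
  rw [lt_div_iff₀ (hk.trans_le h1)]
  have h5 := mul_le_mul_of_nonneg_left h2 (hq n).le
  have h6 := mul_le_mul_of_nonneg_left h1 hε.le
  linarith

variable [Finite C] [Finite X]

/-- Chebyshev's inequality: if the expected sum of squared debts grows at most linearly, then the debts
are `o(k)` in probability. -/
lemma fulfills_of_expect_lyapunov_le {η : PriorityPolicy N C X} {A B : ℝ}
    (hAB : ∀ k : ℕ, expect (M.law η k) (M.lyapunov q) ≤ A + k * B) : M.Fulfills η q := by
  intro ε hε
  have hT := M.T_pos
  set s : ℕ → Set (History N C X) := fun t =>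
    {h | ∀ n, q n - ε < (deliveredBy h n t : ℝ) / ((t : ℝ) / (M.T : ℝ))} with hs_def
  have hdiv : Filter.Tendsto (fun t : ℕ => t / M.T) Filter.atTop Filter.atTop :=
    Nat.tendsto_div_const_atTop hT.ne'
  have hreal : Filter.Tendsto
      (fun t => ((M.law η (t / M.T + 1)).toOuterMeasure (s t)).toReal) Filter.atTop (nhds 1) := by
    have hlarge : ∀ᶠ k : ℕ in Filter.atTop, 0 < k ∧ ∀ n, q n ≤ ε / 2 * k := by
      refine (Filter.eventually_gt_atTop 0).and (Filter.eventually_all.2 fun n => ?_)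
      filter_upwards [(tendsto_natCast_atTop_atTop (R := ℝ)).eventually_ge_atTop
        (q n / (ε / 2))] with k hk
      rw [div_le_iff₀ (half_pos hε)] at hk
      linarith
    have hlower : ∀ᶠ t in Filter.atTop,
        1 - (A + (t / M.T : ℕ) * B) / (ε / 2 * (t / M.T : ℕ)) ^ 2 ≤
          ((M.law η (t / M.T + 1)).toOuterMeasure (s t)).toReal := by
      filter_upwards [hdiv.eventually hlarge] with t ht
      obtain ⟨hk, hkq⟩ := ht
      have hk' : (0 : ℝ) < (t / M.T : ℕ) := Nat.cast_pos.2 hk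
      set y := ε / 2 * ((t / M.T : ℕ) : ℝ) with hy_def
      have hy : 0 < y := mul_pos (half_pos hε) hk'
      -- Chebyshev's inequality: outside of the event some debt is at least `y`.
      have h1 : 1 + (-(1 / y ^ 2)) * expect (M.law η (t / M.T)) (M.lyapunov q) ≤
          ((M.law η (t / M.T + 1)).toOuterMeasure (s t)).toReal := by
        rw [toReal_toOuterMeasure, law_succ, expect_bind,
          ← expect_const (M.law η (t / M.T)) 1, ← expect_const_mul, ← expect_add]
        refine expect_mono fun h hh => le_expect fun h' hh' => ?_
        rw [expect_const]
        obtain ⟨hcomplete, hlen⟩ := M.complete_of_mem_support_law hh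
        obtain ⟨r, rfl, -⟩ := M.mem_support_nextHistory hh'
        have hnn : 0 ≤ 1 / y ^ 2 * M.lyapunov q h :=
          mul_nonneg (by positivity) (Finset.sum_nonneg fun n _ => sq_nonneg _)
        by_cases hmem : r :: h ∈ s t
        · rw [Set.indicator_of_mem hmem, Pi.one_apply]
          linarith
        · rw [Set.indicator_of_notMem hmem]
          obtain ⟨n, hn⟩ : ∃ n, y ≤ M.posDebt q h n := by
            by_contra! hcon
            exact hmem fun n => lt_deliveredBy_div hq hε hcomplete hlen hk n (hkq n) (hcon n)
          have h2 : y ^ 2 ≤ M.lyapunov q h := (pow_le_pow_left₀ hy.le hn 2).trans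
            (Finset.single_le_sum (f := fun n => M.posDebt q h n ^ 2)
              (fun n _ => sq_nonneg _) (Finset.mem_univ n))
          have h3 : 1 ≤ 1 / y ^ 2 * M.lyapunov q h := by
            rw [one_div_mul_eq_div, le_div_iff₀ (by positivity)]
            linarith
          linarith
      refine le_trans ?_ h1
      have h4 := mul_le_mul_of_nonneg_left (hAB (t / M.T)) (by positivity : 0 ≤ 1 / y ^ 2)
      rw [one_div_mul_eq_div _ (A + _)] at h4
      linarith
    have hlim : Filter.Tendsto
        (fun k : ℕ => 1 - (A + k * B) / (ε / 2 * (k : ℝ)) ^ 2) Filter.atTop (nhds 1) := by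
      have h0 : Filter.Tendsto (fun k : ℕ => 1 / (k : ℝ)) Filter.atTop (nhds 0) :=
        tendsto_one_div_atTop_nhds_zero_nat
      have h1 : Filter.Tendsto (fun k : ℕ => 1 - (A * (1 / (k : ℝ)) ^ 2 + B * (1 / (k : ℝ))) /
          (ε / 2) ^ 2) Filter.atTop (nhds (1 - (A * 0 ^ 2 + B * 0) / (ε / 2) ^ 2)) :=
        ((((h0.pow 2).const_mul A).add (h0.const_mul B)).div_const _).const_sub 1
      refine Filter.Tendsto.congr' ?_ (by simpa using h1)
      filter_upwards [Filter.eventually_gt_atTop 0] with k hk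
      have : (k : ℝ) ≠ 0 := Nat.cast_ne_zero.2 hk.ne'
      field_simp
    refine tendsto_of_tendsto_of_tendsto_of_le_of_le' (hlim.comp hdiv) tendsto_const_nhds hlower
      (Filter.Eventually.of_forall fun t => ?_)
    exact ENNReal.toReal_le_of_le_ofReal zero_le_one (by simpa using toOuterMeasure_le_one _ _)
  refine (ENNReal.tendsto_toReal_iff (fun t => ?_) ENNReal.one_ne_top).1 (by simpa using hreal)
  exact ne_top_of_le_ne_top ENNReal.one_ne_top (toOuterMeasure_le_one _ _)

end System

end DebtScheduling

theorem mainTheorem2 {N : ℕ} {C X : Type*} [Finite C] [Finite X]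
    (M : DebtScheduling.System N C X) :
    (∀ (r : Fin N → ℝ) (c : C) (S : Finset (Fin N))
        (D D' : PMF (DebtScheduling.PriorityOrder N)),
        (∀ l ∈ D.support, M.IsJointDebtChannelOrder r c S l) →
        M.payoff r c S D' ≤ M.payoff r c S D) ∧
    (∀ q : Fin N → ℝ, ∃ η : DebtScheduling.PriorityPolicy N C X,
        M.IsJointDebtChannelPolicy q η) ∧
    (∀ η : (Fin N → ℝ) → DebtScheduling.PriorityPolicy N C X,
        (∀ q : Fin N → ℝ, M.IsJointDebtChannelPolicy q (η q)) →
        M.FeasibilityOptimal η) := by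
  refine ⟨fun r c S D D' hD => M.payoff_le_payoff hD D', M.exists_isJointDebtChannelPolicy,
    fun η hη q hq hfeas => ?_⟩
  obtain ⟨m, hm, hopt⟩ := M.exists_le_optTotal hq hfeas
  obtain ⟨A, B, hAB⟩ := DebtScheduling.System.exists_expect_lyapunov_le hq (hη q) hm hopt
  exact DebtScheduling.System.fulfills_of_expect_lyapunov_le hq hAB
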